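/- Let $\mathbb{K}$ be the field of nonstandard real numbers or, more generally, any linearly ordered field. Call $x\in\mathbb K$ limited if $|x|\le m$ for some standard natural number $m$, and infinitesimal if $x=0$ or $1/x$ is not limited; let $\pounds$ and $\oslash$ be the sets of limited and of infinitesimal numbers. A neutrix is a convex additive subgroup of $\mathbb K$; an external number is a set $\alpha=a+A$ with $a\in\mathbb K$ and $A=N(\alpha)$ a neutrix; $\alpha$ is zeroless if $0\notin\alpha$, and $|a+A|=|a|+A$. Sums, products and quotients of external numbers (by zeroless ones) are Minkowski operations, products with matrices and determinants are formed from them as usual, and external numbers are ordered by $\alpha\le\beta\iff\forall a\in\alpha\,\exists b\in\beta\ (a\le b)$; neutrices are ordered by inclusion. Let $n\ge 1$ be standard, $\mathcal A=[\alpha_{ij}]$ an $n\times n$ matrix of external numbers, $\Delta=\det\mathcal A$, $\mathcal B=(\beta_1,\dots,\beta_n)^T$ a vector of external numbers, $\overline A=\max_{i,j}N(\alpha_{ij})$, $\underline B=\min_iN(\beta_i)$, $|\overline\beta|=\max_i|\beta_i|$. Put $R(\mathcal A)=\overline A/\Delta$ if $\Delta$ is zeroless, and $R(\mathcal B)=\underline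 B/|\overline\beta|$ if $|\overline\beta|$ is zeroless, $R(\mathcal B)=\{c\in\mathbb K: c|\overline\beta|\subseteq\underline B\}$ if $|\overline\beta|$ is a neutrix. Assume that the system $\mathcal A|\mathcal B$, i.e. $\mathcal Ax\subseteq\mathcal B$ with $x\in\mathbb K^n$, is: (a) uniform: $N(\beta_1)=\dots=N(\beta_n)$; (b) reduced: $\max_{i,j}|\alpha_{ij}|=\alpha_{11}$, $\alpha_{11}=1+A_{11}$ with $A_{11}\subseteq\oslash$, and every other $\alpha_{ij}$ contains some $a$ with $|a|\le1$; (c) non-singular and stable: $\max_{i,j}|\alpha_{ij}|\subset\pounds$, $\Delta$ is zeroless, $R(\mathcal A)\subseteq\oslash$, $R(\mathcal A)\subseteq R(\mathcal B)$, and $\Delta$ is not an absorber of $\underline B$, i.e. it is not true that $\Delta\underline B\subset\underline B$ (strict inclusion); (d) properly arranged with respect to a representative matrix $P=[a_{ij}]$ (that is, $a_{ij}\in\alpha_{ij}$): $|a_{ij}|\le|a_{11}|$ for all $i,j$, and for $1\le k\le n-1$ and $i,j\ge k+1$ the minor of $P$ with rows $1,\dots,k,i$ and columns $1,\dots,k,j$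 is in absolute value at most the leading principal minor of order $k+1$. Let $\mathcal G_1,\dots,\mathcal G_{2n}$ be the Gauss–Jordan operation matrices of $P$: $P^{(0)}=P$, $P^{(q)}=\mathcal G_qP^{(q-1)}$, where for $0\le k<n$ the matrix $\mathcal G_{2k+1}$ divides row $k+1$ by the pivot $P^{(2k)}_{k+1,k+1}$, and $\mathcal G_{2k+2}$ subtracts $P^{(2k+1)}_{i,k+1}$ times row $k+1$ from row $i$, for each $i\ne k+1$. Write $\mathcal G^P(X)=\mathcal G_{2n}(\mathcal G_{2n-1}\cdots(\mathcal G_1X))$. Let $S=\{x\in\mathbb K^n:\mathcal Ax\subseteq\mathcal B\}$ be the solution, $G^P=\{x\in\mathbb K^n:\mathcal G^P(\mathcal A)\,x\subseteq\mathcal G^P(\mathcal B)\}$ the Gauss–Jordan solution with respect to $P$, and $M_j$ the matrix obtained from $\mathcal A$ by replacing column $j$ by $\mathcal B$. Then $G^P=:G$ does not depend on the choice of a representative matrix $P$ as in (d), and, identifying a vector of external numbers with the set of its representative vectors, $$S=G=\mathcal G^P(\mathcal B)=\left(\frac{\det M_1}{\Delta},\dots,\frac{\det M_n}{\Delta}\right)^T,$$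 the latter being a vector of external numbers. The same equalities hold if in $\mathcal G^P(\mathcal A)$ and $\mathcal G^P(\mathcal B)$ the product $\mathcal G_{2n}(\mathcal G_{2n-1}\cdots(\mathcal G_2\mathcal G_1))$ is first multiplied out to a single real matrix. -/

import Mathlib

open scoped Pointwise

/-!
Throughout, `K` is a linearly ordered field playing the role of the nonstandard real numbers and
the elements of Lean's `ℕ` (cast into `K`) are the standard natural numbers.
External numbers are certain subsets of `K`; all operations on them are the Minkowski operations
on sets, that is, the pointwise operations of `Set K`.
-/

section ExternalNumbers

variable {K : Type*} [Field K] [LinearOrder K]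

/-- The set of limited numbers: those bounded in absolute value by a standard natural number. -/
def limitedNumbers (K : Type*) [Field K] [LinearOrder K] : Set K :=
  {x | ∃ m : ℕ, |x| ≤ (m : K)}

/-- The set of infinitesimals: zero and the reciprocals of the unlimited numbers. -/
def infinitesimals (K : Type*) [Field K] [LinearOrder K] : Set K :=
  {x | x = 0 ∨ x⁻¹ ∉ limitedNumbers K}

/-- A (scalar) neutrix is a convex additive subgroup. -/
def IsNeutrix (A : Set K) : Prop :=
  ∃ H : AddSubgroup K, (H : Set K) = A ∧ A.OrdConnected

/-- An external number is the Minkowski sum of a number and a neutrix. -/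
def IsExternalNumber (α : Set K) : Prop :=
  ∃ a : K, ∃ A : Set K, IsNeutrix A ∧ α = {a} + A

/-- The neutrix part `N(α)`; for `α = a + A` this is `A - A = A`. -/
def neutrixPart (α : Set K) : Set K := α - α

/-- `α` is zeroless. -/
def IsZeroless (α : Set K) : Prop := (0 : K) ∉ α

/-- The order relation on external numbers. -/
def extLE (α β : Set K) : Prop := ∀ a ∈ α, ∃ b ∈ β, a ≤ b

/-- The absolute value `|a + A| = |a| + A`. -/
def extAbs (α : Set K) : Set K := (fun x => |x|) '' α + neutrixPart α

/-- The maximum of the absolute values of a finite family of external numbers. The relation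
`extLE` is a total order on external numbers, so all the maximal `extAbs (α i)` coincide and the
union below is their common value. -/
def maxAbs {ι : Type*} (α : ι → Set K) : Set K :=
  {x | ∃ i, (∀ j, extLE (extAbs (α j)) (extAbs (α i))) ∧ x ∈ extAbs (α i)}

/-- The quotient `A : B` of two neutrices. -/
def neutrixQuot (A B : Set K) : Set K := {c | {c} * B ⊆ A}

/-- `α` is an absorber of the neutrix `N`: the product `α N` is strictly included in `N`. -/
def IsAbsorber (α N : Set K) : Prop := α * N ⊂ N

end ExternalNumbers

section ExternalMatrices

variable {K : Type*} [Field K] [LinearOrder K] {n : ℕ}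

/-- The product of two square matrices of external numbers. -/
def extMul (𝒜 ℬ : Matrix (Fin n) (Fin n) (Set K)) : Matrix (Fin n) (Fin n) (Set K) :=
  fun i j => ∑ k, 𝒜 i k * ℬ k j

/-- The product of a matrix of external numbers and an external vector. -/
def extMulVec (𝒜 : Matrix (Fin n) (Fin n) (Set K)) (ξ : Fin n → Set K) : Fin n → Set K :=
  fun i => ∑ k, 𝒜 i k * ξ k

/-- A real matrix as a matrix of external numbers. -/
def toExtMatrix (P : Matrix (Fin n) (Fin n) K) : Matrix (Fin n) (Fin n) (Set K) :=
  fun i j => {P i j}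

/-- A real vector as an external vector. -/
def toExtVec (x : Fin n → K) : Fin n → Set K := fun i => {x i}

/-- The determinant of a matrix of external numbers, as the sum of signed products. -/
def extDet (𝒜 : Matrix (Fin n) (Fin n) (Set K)) : Set K :=
  ∑ σ : Equiv.Perm (Fin n), {((Equiv.Perm.sign σ : ℤ) : K)} * ∏ i, 𝒜 (σ i) i

/-- `P` is a representative matrix of `𝒜`. -/
def IsRepresentative (𝒜 : Matrix (Fin n) (Fin n) (Set K)) (P : Matrix (Fin n) (Fin n) K) : Prop :=
  ∀ i j, P i j ∈ 𝒜 i j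

/-- The biggest of the absolute values of the entries of `𝒜`. -/
def matrixMaxAbs (𝒜 : Matrix (Fin n) (Fin n) (Set K)) : Set K :=
  maxAbs (fun p : Fin n × Fin n => 𝒜 p.1 p.2)

/-- The biggest neutrix part of the entries of `𝒜`. Neutrices are totally ordered by inclusion,
so the maximum of finitely many of them is their union. -/
def matrixMaxNeutrix (𝒜 : Matrix (Fin n) (Fin n) (Set K)) : Set K :=
  ⋃ i, ⋃ j, neutrixPart (𝒜 i j)

/-- `𝒜` is limited. -/
def IsLimitedMatrix (𝒜 : Matrix (Fin n) (Fin n) (Set K)) : Prop :=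
  matrixMaxAbs 𝒜 ⊂ limitedNumbers K

/-- `𝒜` is reduced: its upper left entry is its biggest entry in absolute value and is of the form
`1 + A` with `A` included in the infinitesimals, and all other entries have representatives which
are at most `1` in absolute value. -/
def IsReducedMatrix [NeZero n] (𝒜 : Matrix (Fin n) (Fin n) (Set K)) : Prop :=
  matrixMaxAbs 𝒜 = 𝒜 0 0 ∧
  (1 : K) ∈ 𝒜 0 0 ∧ neutrixPart (𝒜 0 0) ⊆ infinitesimals K ∧
  ∀ i j, (i, j) ≠ (0, 0) → ∃ a ∈ 𝒜 i j, |a| ≤ 1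

/-- `𝒜` is non-singular: its determinant is zeroless. -/
def IsNonsingularMatrix (𝒜 : Matrix (Fin n) (Fin n) (Set K)) : Prop :=
  IsZeroless (extDet 𝒜)

/-- The relative uncertainty `R(𝒜)` of a matrix. -/
def matrixUncertainty (𝒜 : Matrix (Fin n) (Fin n) (Set K)) : Set K :=
  matrixMaxNeutrix 𝒜 / extDet 𝒜

/-- `𝒜` is a stable matrix. -/
def IsStableMatrix (𝒜 : Matrix (Fin n) (Fin n) (Set K)) : Prop :=
  IsLimitedMatrix 𝒜 ∧ IsNonsingularMatrix 𝒜 ∧ matrixUncertainty 𝒜 ⊆ infinitesimals K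

end ExternalMatrices

section GaussJordan

variable {K : Type*} [Field K] {n : ℕ}

/-- The Gauss-Jordan operation matrix dividing row `k` of `M` by the pivot `M k k`. -/
def gaussJordanScale (M : Matrix (Fin n) (Fin n) K) (k : Fin n) : Matrix (Fin n) (Fin n) K :=
  fun i j => if i = j then (if i = k then (M k k)⁻¹ else 1) else 0

/-- The Gauss-Jordan operation matrix annihilating the entries `M i k`, `i ≠ k`, of column `k` of
a matrix `M` with `M k k = 1`. -/
def gaussJordanClear (M : Matrix (Fin n) (Fin n) K) (k : Fin n) : Matrix (Fin n) (Fin n) K :=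
  fun i j => if j = i then 1 else if j = k then -M i k else 0

/-- The Gauss-Jordan operation matrix of index `q + 1` obtained from the intermediate matrix `M` of
index `q`. With rows and columns indexed from `0`, the operations of (one-based) index `2k + 1` and
`2k + 2` are the two operations with pivot position `k`. For `2n ≤ q` nothing is left to do. -/
def gaussJordanNext (M : Matrix (Fin n) (Fin n) K) (q : ℕ) : Matrix (Fin n) (Fin n) K :=
  if h : q / 2 < n then
    if q % 2 = 0 then gaussJordanScale M ⟨q / 2, h⟩ else gaussJordanClear M ⟨q / 2, h⟩
  else 1

/-- The intermediate matrix `P^(q)`. -/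
def gaussJordanInter (P : Matrix (Fin n) (Fin n) K) : ℕ → Matrix (Fin n) (Fin n) K
  | 0 => P
  | q + 1 => gaussJordanNext (gaussJordanInter P q) q * gaussJordanInter P q

/-- The Gauss-Jordan operation matrix `𝒢_q^P`. -/
def gaussJordanOp (P : Matrix (Fin n) (Fin n) K) : ℕ → Matrix (Fin n) (Fin n) K
  | 0 => 1
  | q + 1 => gaussJordanNext (gaussJordanInter P q) q

/-- The real matrix `𝒢_q^P (𝒢_{q-1}^P ⋯ (𝒢_2^P 𝒢_1^P))`. -/
def gaussJordanProd (P : Matrix (Fin n) (Fin n) K) : ℕ → Matrix (Fin n) (Fin n) K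
  | 0 => 1
  | q + 1 => gaussJordanOp P (q + 1) * gaussJordanProd P q

/-- The intermediate matrix `𝒜^(q) = 𝒢_q^P (𝒢_{q-1}^P ⋯ (𝒢_1^P 𝒜))`. -/
def gaussJordanMatrix (P : Matrix (Fin n) (Fin n) K) (𝒜 : Matrix (Fin n) (Fin n) (Set K)) :
    ℕ → Matrix (Fin n) (Fin n) (Set K)
  | 0 => 𝒜
  | q + 1 => extMul (toExtMatrix (gaussJordanOp P (q + 1))) (gaussJordanMatrix P 𝒜 q)

/-- The intermediate right-hand member `ℬ^(q) = 𝒢_q^P (𝒢_{q-1}^P ⋯ (𝒢_1^P ℬ))`. -/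
def gaussJordanVec (P : Matrix (Fin n) (Fin n) K) (ℬ : Fin n → Set K) : ℕ → Fin n → Set K
  | 0 => ℬ
  | q + 1 => extMulVec (toExtMatrix (gaussJordanOp P (q + 1))) (gaussJordanVec P ℬ q)

/-- The leading principal minor of order `k`. -/
def leadingMinor (P : Matrix (Fin n) (Fin n) K) (k : ℕ) (hk : k ≤ n) : K :=
  (P.submatrix (Fin.castLE hk) (Fin.castLE hk)).det

/-- The minor of order `k + 1` of the first `k` rows and row `i`, and the first `k` columns and
column `j`. -/
def borderedMinor (P : Matrix (Fin n) (Fin n) K) (k : ℕ) (hk : k ≤ n) (i j : Fin n) : K :=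
  (P.submatrix (Fin.snoc (α := fun _ => Fin n) (Fin.castLE hk) i)
    (Fin.snoc (α := fun _ => Fin n) (Fin.castLE hk) j)).det

/-- The real matrix `P` is properly arranged. The case `k = 0` says that all entries are in
absolute value at most the upper left one. -/
def IsProperlyArranged [LinearOrder K] (P : Matrix (Fin n) (Fin n) K) : Prop :=
  ∀ (k : ℕ) (hk : k < n) (i j : Fin n), k ≤ (i : ℕ) → k ≤ (j : ℕ) →
    |borderedMinor P k hk.le i j| ≤ |leadingMinor P (k + 1) hk|

/-- `𝒜` is (reduced, non-singular and) properly arranged with respect to the representative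
matrix `P`. -/
def IsProperlyArrangedWrt [LinearOrder K] [NeZero n] (𝒜 : Matrix (Fin n) (Fin n) (Set K))
    (P : Matrix (Fin n) (Fin n) K) : Prop :=
  IsReducedMatrix 𝒜 ∧ IsNonsingularMatrix 𝒜 ∧ IsRepresentative 𝒜 P ∧ IsProperlyArranged P

end GaussJordan

section FlexibleSystems

variable {K : Type*} [Field K] [LinearOrder K] {n : ℕ}

/-- The smallest neutrix part of the components of `ℬ`. -/
def vecMinNeutrix (ℬ : Fin n → Set K) : Set K := ⋂ i, neutrixPart (ℬ i)

open Classical in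
/-- The relative uncertainty `R(ℬ)` of an external vector. The biggest absolute value of its
components is an external number, hence either zeroless or a neutrix. -/
noncomputable def vecUncertainty (ℬ : Fin n → Set K) : Set K :=
  if IsZeroless (maxAbs ℬ) then vecMinNeutrix ℬ / maxAbs ℬ
  else neutrixQuot (vecMinNeutrix ℬ) (maxAbs ℬ)

/-- The system `𝒜 | ℬ` is uniform: the neutrix parts of the right-hand member are the same. -/
def IsUniformVec (ℬ : Fin n → Set K) : Prop :=
  ∀ i j, neutrixPart (ℬ i) = neutrixPart (ℬ j)

/-- The system `𝒜 | ℬ` is stable. -/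
def IsStableSystem (𝒜 : Matrix (Fin n) (Fin n) (Set K)) (ℬ : Fin n → Set K) : Prop :=
  IsStableMatrix 𝒜 ∧
  matrixUncertainty 𝒜 ⊆ vecUncertainty ℬ ∧
  ¬ IsAbsorber (extDet 𝒜) (vecMinNeutrix ℬ)

/-- The solution of `𝒜 | ℬ`: the set of all real vectors `x` with `𝒜 x ⊆ ℬ`. -/
def flexSolution (𝒜 : Matrix (Fin n) (Fin n) (Set K)) (ℬ : Fin n → Set K) : Set (Fin n → K) :=
  {x | ∀ i, extMulVec 𝒜 (toExtVec x) i ⊆ ℬ i}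

/-- The Gauss-Jordan solution `G^P` of `𝒜 | ℬ` with respect to `P`. -/
def gaussJordanSolution (P : Matrix (Fin n) (Fin n) K) (𝒜 : Matrix (Fin n) (Fin n) (Set K))
    (ℬ : Fin n → Set K) : Set (Fin n → K) :=
  flexSolution (gaussJordanMatrix P 𝒜 (2 * n)) (gaussJordanVec P ℬ (2 * n))

/-- The vector with components `det M_j / Δ`, where `M_j` is obtained from `𝒜` by substituting
the right-hand member `ℬ` for column `j`. -/
def cramerVec (𝒜 : Matrix (Fin n) (Fin n) (Set K)) (ℬ : Fin n → Set K) : Fin n → Set K :=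
  fun j => extDet (𝒜.updateCol j ℬ) / extDet 𝒜

/-- The set of representative vectors of an external vector, with which it is identified. -/
def extVecSet (ξ : Fin n → Set K) : Set (Fin n → K) := {x | ∀ i, x i ∈ ξ i}

end FlexibleSystems

/-! ### Gauss-Jordan elimination of a real matrix: minors, pivots, unit columns. -/

section Elimination

variable {K : Type*} [Field K] {n : ℕ}

/-! Everything is linear algebra modulo the common neutrix `B` of the right-hand side. Write `β_i =
b_i + B`, let `O = {c | c B ⊆ B}` (a convex subring of `K`) and let `J` be the set of `w ∈ O` with
`w b_i ∈ B` for all `i`, which is stable under multiplication by `O`. Stability enters only through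
`stableSystem_congruences`: entries of `𝒜` lie in `O`, two representatives of an entry differ by an
element of `J`, and every element of `Δ` is invertible in `O`.

Hence a representative matrix `P` is invertible over `O`. With `y = P⁻¹ b`, the errors in `J` carry
`y + Bⁿ` into `B`, so `𝒜 x ⊆ ℬ` reduces to `P x ≡ b` modulo `B`, that is, to `x ∈ y + Bⁿ`
(`flexSolution_eq`). Cramer's quotients are the cosets `y_j + B` for the same reason
(`mem_cramerVec_iff`).

For the Gauss-Jordan operations, proper arrangement bounds the normalized pivot rows by `1`. Since
the product of the pivots is `det P`, the operation matrices have entries in `O` and diagonal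
entries invertible in `O` (`gaussJordanOp_mem`, `gaussJordanOp_diag`). Each operation thus respects
congruence modulo `J` and sends a coset of `Bⁿ` to full cosets of `B` in every component. The
transformed system has representative matrix `1` and right-hand side `y + Bⁿ`, whose solution is
again `y + Bⁿ`. -/

theorem gaussJordanScale_mul_apply (M N : Matrix (Fin n) (Fin n) K) (k i j : Fin n) :
    (gaussJordanScale M k * N) i j = (if i = k then (M k k)⁻¹ else 1) * N i j := by
  simp [Matrix.mul_apply, gaussJordanScale, ite_mul]

theorem gaussJordanClear_mul_apply (M N : Matrix (Fin n) (Fin n) K) (k i j : Fin n) :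
    (gaussJordanClear M k * N) i j = N i j + (if i = k then 0 else -M i k) * N k j := by
  rw [Matrix.mul_apply]
  have h : ∀ l, gaussJordanClear M k i l * N l j =
      (if l = i then N l j else 0) +
        if l = k then (if i = k then 0 else -M i k) * N l j else 0 := by
    intro l
    unfold gaussJordanClear
    split_ifs <;> simp_all
  simp [h, Finset.sum_add_distrib]

theorem gaussJordanNext_even (M : Matrix (Fin n) (Fin n) K) {k : ℕ} (hk : k < n) :
    gaussJordanNext M (2 * k) = gaussJordanScale M ⟨k, hk⟩ := by
  have h : 2 * k / 2 = k := by omega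
  simp [gaussJordanNext, h, hk]

theorem gaussJordanNext_odd (M : Matrix (Fin n) (Fin n) K) {k : ℕ} (hk : k < n) :
    gaussJordanNext M (2 * k + 1) = gaussJordanClear M ⟨k, hk⟩ := by
  have h : (2 * k + 1) / 2 = k := by omega
  have h' : (2 * k + 1) % 2 = 1 := by omega
  simp [gaussJordanNext, h, h', hk]

theorem gaussJordanInter_odd_apply (P : Matrix (Fin n) (Fin n) K) {k : ℕ} (hk : k < n)
    (i j : Fin n) :
    gaussJordanInter P (2 * k + 1) i j =
      (if i = ⟨k, hk⟩ then (gaussJordanInter P (2 * k) ⟨k, hk⟩ ⟨k, hk⟩)⁻¹ else 1) *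
        gaussJordanInter P (2 * k) i j := by
  rw [gaussJordanInter, gaussJordanNext_even _ hk, gaussJordanScale_mul_apply]

theorem gaussJordanInter_even_apply (P : Matrix (Fin n) (Fin n) K) {k : ℕ} (hk : k < n)
    (i j : Fin n) :
    gaussJordanInter P (2 * (k + 1)) i j =
      gaussJordanInter P (2 * k + 1) i j +
        (if i = ⟨k, hk⟩ then 0 else -gaussJordanInter P (2 * k) i ⟨k, hk⟩) *
          gaussJordanInter P (2 * k + 1) ⟨k, hk⟩ j := by
  rw [show 2 * (k + 1) = (2 * k + 1) + 1 by ring, gaussJordanInter, gaussJordanNext_odd _ hk,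
    gaussJordanClear_mul_apply]
  congr 2
  split_ifs with h
  · rfl
  · rw [gaussJordanInter_odd_apply P hk, if_neg h, one_mul]

theorem gaussJordanInter_eq_prod_mul (P : Matrix (Fin n) (Fin n) K) (q : ℕ) :
    gaussJordanInter P q = gaussJordanProd P q * P := by
  induction q with
  | zero => simp [gaussJordanInter, gaussJordanProd]
  | succ q ih =>
    rw [gaussJordanInter, gaussJordanProd, Matrix.mul_assoc, ← ih, gaussJordanOp]

/-- The pivot used at position `t` (counted from `0`) of the Gauss-Jordan procedure. -/
def gaussJordanPivot (P : Matrix (Fin n) (Fin n) K) (t : ℕ) : K :=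
  if h : t < n then gaussJordanInter P (2 * t) ⟨t, h⟩ ⟨t, h⟩ else 1

theorem gaussJordanPivot_of_lt (P : Matrix (Fin n) (Fin n) K) {t : ℕ} (h : t < n) :
    gaussJordanPivot P t = gaussJordanInter P (2 * t) ⟨t, h⟩ ⟨t, h⟩ := dif_pos h

/-- Minors whose rows include exactly once the pivotal row are divided by the pivot. -/
theorem det_submatrix_gaussJordanInter_succ (P : Matrix (Fin n) (Fin n) K) {k m : ℕ} (hk : k < n)
    (r c : Fin m → Fin n) (a₀ : Fin m) (hr : ∀ a, r a = ⟨k, hk⟩ ↔ a = a₀) :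
    ((gaussJordanInter P (2 * (k + 1))).submatrix r c).det =
      (gaussJordanPivot P k)⁻¹ * ((gaussJordanInter P (2 * k)).submatrix r c).det := by
  have hra : r a₀ = ⟨k, hk⟩ := (hr a₀).2 rfl
  have h₁ : ((gaussJordanInter P (2 * (k + 1))).submatrix r c).det =
      ((gaussJordanInter P (2 * k + 1)).submatrix r c).det := by
    refine Matrix.det_eq_of_forall_row_eq_smul_add_const
      (fun a => if r a = ⟨k, hk⟩ then 0 else -gaussJordanInter P (2 * k) (r a) ⟨k, hk⟩) a₀
      (by simp [hra]) fun a b => ?_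
    simp only [Matrix.submatrix_apply]
    rw [gaussJordanInter_even_apply P hk, hra]
  have h₂ : (gaussJordanInter P (2 * k + 1)).submatrix r c =
      Matrix.of fun a b => (if a = a₀ then (gaussJordanPivot P k)⁻¹ else 1) *
        (gaussJordanInter P (2 * k)).submatrix r c a b := by
    ext a b
    simp only [Matrix.submatrix_apply, Matrix.of_apply]
    rw [gaussJordanInter_odd_apply P hk, gaussJordanPivot_of_lt P hk]
    simp only [hr]
  rw [h₁, h₂, Matrix.det_mul_column]
  simp

/-- Clearing adds multiples of a row already in the minor, so only the divisions by the pivots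
count, once for each pivotal row. -/
theorem det_submatrix_gaussJordanInter (P : Matrix (Fin n) (Fin n) K) {m : ℕ}
    (r c : Fin m → Fin n) (k : ℕ)
    (hr : ∀ (t : ℕ) (_ : t < k), ∃ (h : t < n) (a₀ : Fin m), ∀ a, r a = ⟨t, h⟩ ↔ a = a₀) :
    ((gaussJordanInter P (2 * k)).submatrix r c).det =
      (∏ t ∈ Finset.range k, (gaussJordanPivot P t)⁻¹) * (P.submatrix r c).det := by
  induction k with
  | zero => simp [gaussJordanInter]
  | succ k ih =>
    obtain ⟨hk, a₀, ha⟩ := hr k (by omega)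
    rw [det_submatrix_gaussJordanInter_succ P hk r c a₀ ha,
      ih fun t ht => hr t (by omega), Finset.prod_range_succ]
    ring

theorem det_gaussJordanInter (P : Matrix (Fin n) (Fin n) K) {k : ℕ} (hk : k ≤ n) :
    (gaussJordanInter P (2 * k)).det =
      (∏ t ∈ Finset.range k, (gaussJordanPivot P t)⁻¹) * P.det := by
  simpa using det_submatrix_gaussJordanInter P id id k
    fun t ht => ⟨ht.trans_le hk, ⟨t, ht.trans_le hk⟩, fun _ => Iff.rfl⟩

theorem gaussJordanInter_col (P : Matrix (Fin n) (Fin n) K) {k : ℕ} (hk : k ≤ n)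
    (hp : ∀ t < k, gaussJordanPivot P t ≠ 0) (i j : Fin n) (hj : (j : ℕ) < k) :
    gaussJordanInter P (2 * k) i j = if i = j then 1 else 0 := by
  induction k generalizing i j with
  | zero => omega
  | succ k ih =>
    have hkn : k < n := hk
    have hpk := hp k (by omega)
    rw [gaussJordanPivot_of_lt P hkn] at hpk
    have ih' := fun i j hj => ih (by omega) (fun t ht => hp t (by omega)) i j hj
    rw [gaussJordanInter_even_apply P hkn, gaussJordanInter_odd_apply P hkn,
      gaussJordanInter_odd_apply P hkn]
    rcases Nat.lt_succ_iff_lt_or_eq.1 hj with h | h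
    · have hkj : (⟨k, hkn⟩ : Fin n) ≠ j := fun e => by simp [← e] at h
      rw [ih' i j h, ih' _ j h, if_neg hkj]
      by_cases hik : i = ⟨k, hkn⟩
      · simp [hik, hkj]
      · simp [hik]
    · obtain rfl : j = ⟨k, hkn⟩ := Fin.ext h
      by_cases hik : i = ⟨k, hkn⟩
      · simp [hik, hpk]
      · simp [hik, hpk]

theorem gaussJordanInter_two_mul (P : Matrix (Fin n) (Fin n) K)
    (hp : ∀ t < n, gaussJordanPivot P t ≠ 0) : gaussJordanInter P (2 * n) = 1 := by
  ext i j
  rw [gaussJordanInter_col P le_rfl hp i j j.2, Matrix.one_apply]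

/-- The bordered matrix is upper triangular, with ones followed by `M i j` on the diagonal. -/
theorem borderedMinor_of_col {M : Matrix (Fin n) (Fin n) K} {k : ℕ} (hk : k ≤ n)
    (hM : ∀ i j : Fin n, (j : ℕ) < k → M i j = if i = j then 1 else 0) (i j : Fin n)
    (hi : k ≤ (i : ℕ)) : borderedMinor M k hk i j = M i j := by
  unfold borderedMinor
  rw [Matrix.det_of_isUpperTriangular]
  · rw [Fin.prod_univ_castSucc]
    simp [hM]
  · intro a b hab
    obtain ⟨b, rfl⟩ : ∃ b' : Fin k, b = b'.castSucc :=
      ⟨b.castPred (ne_of_lt (lt_of_lt_of_le hab (Fin.le_last a))), by simp⟩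
    simp only [Matrix.submatrix_apply, Fin.snoc_castSucc]
    rw [hM _ _ (by simp), if_neg]
    intro e
    induction a using Fin.lastCases with
    | last =>
      simp only [Fin.snoc_last] at e
      have := congrArg Fin.val e
      simp at this
      omega
    | cast a =>
      simp only [Fin.snoc_castSucc] at e
      have := congrArg Fin.val e
      have hab' : (b : ℕ) < a := hab
      simp at this
      omega

theorem borderedMinor_self (P : Matrix (Fin n) (Fin n) K) {k : ℕ} (hk : k < n) :
    borderedMinor P k hk.le ⟨k, hk⟩ ⟨k, hk⟩ = leadingMinor P (k + 1) hk := by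
  have h : Fin.snoc (α := fun _ => Fin n) (Fin.castLE hk.le) ⟨k, hk⟩ =
      Fin.castLE (show k + 1 ≤ n from hk) := by
    ext a
    induction a using Fin.lastCases with
    | last => simp
    | cast a => simp
  unfold borderedMinor leadingMinor
  rw [h]

/-- The factor does not depend on `i` and `j`, so comparing entries of the intermediate matrix
amounts to comparing minors of `P`. -/
theorem gaussJordanInter_apply_eq_borderedMinor (P : Matrix (Fin n) (Fin n) K) {k : ℕ}
    (hk : k ≤ n) (hp : ∀ t < k, gaussJordanPivot P t ≠ 0) (i j : Fin n) (hi : k ≤ (i : ℕ)) :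
    gaussJordanInter P (2 * k) i j =
      (∏ t ∈ Finset.range k, (gaussJordanPivot P t)⁻¹) * borderedMinor P k hk i j := by
  rw [← borderedMinor_of_col hk (gaussJordanInter_col P hk hp) i j hi]
  refine det_submatrix_gaussJordanInter P _ _ k fun t ht =>
    ⟨ht.trans_le hk, Fin.castSucc ⟨t, ht⟩, fun a => ?_⟩
  induction a using Fin.lastCases with
  | last =>
    simp only [Fin.snoc_last]
    constructor
    · rintro rfl
      simp at hi
      omega
    · intro e
      exact absurd e (Fin.castSucc_lt_last _).ne'
  | cast a =>
    simp [Fin.ext_iff]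

/-! ### Consequences of proper arrangement for pivots and operation matrices. -/

variable [LinearOrder K] [IsStrictOrderedRing K]

theorem abs_gaussJordanInter_le_pivot {P : Matrix (Fin n) (Fin n) K} (hP : IsProperlyArranged P)
    {k : ℕ} (hk : k < n) (hp : ∀ t < k, gaussJordanPivot P t ≠ 0) (i j : Fin n)
    (hi : k ≤ (i : ℕ)) (hj : k ≤ (j : ℕ)) :
    |gaussJordanInter P (2 * k) i j| ≤ |gaussJordanPivot P k| := by
  rw [gaussJordanPivot_of_lt P hk, gaussJordanInter_apply_eq_borderedMinor P hk.le hp i j hi,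
    gaussJordanInter_apply_eq_borderedMinor P hk.le hp ⟨k, hk⟩ ⟨k, hk⟩ le_rfl,
    borderedMinor_self P hk, abs_mul, abs_mul]
  exact mul_le_mul_of_nonneg_left (hP k hk i j hi hj) (abs_nonneg _)

/-- A zero pivot, being maximal in the remaining block, would annihilate its row there; the row
already vanishes in the earlier unit columns, contradicting `P.det ≠ 0`. -/
theorem gaussJordanPivot_ne_zero {P : Matrix (Fin n) (Fin n) K} (hP : IsProperlyArranged P)
    (hdet : P.det ≠ 0) (t : ℕ) : gaussJordanPivot P t ≠ 0 := by
  induction t using Nat.strong_induction_on with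
  | _ k ih =>
  by_cases hk : k < n
  · intro h0
    have hd : (gaussJordanInter P (2 * k)).det ≠ 0 := by
      rw [det_gaussJordanInter P hk.le]
      exact mul_ne_zero (Finset.prod_ne_zero_iff.2 fun t ht =>
        inv_ne_zero (ih t (Finset.mem_range.1 ht))) hdet
    refine hd (Matrix.det_eq_zero_of_row_eq_zero ⟨k, hk⟩ fun j => ?_)
    by_cases hj : (j : ℕ) < k
    · rw [gaussJordanInter_col P hk.le ih _ j hj, if_neg]
      rintro rfl
      simp at hj
    · have := abs_gaussJordanInter_le_pivot hP hk ih ⟨k, hk⟩ j le_rfl (not_lt.1 hj)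
      rw [h0, abs_zero] at this
      exact abs_nonpos_iff.1 this
  · simp [gaussJordanPivot, hk]

theorem prod_gaussJordanPivot {P : Matrix (Fin n) (Fin n) K} (hP : IsProperlyArranged P)
    (hdet : P.det ≠ 0) : ∏ t ∈ Finset.range n, gaussJordanPivot P t = P.det := by
  have h := det_gaussJordanInter P le_rfl
  rw [gaussJordanInter_two_mul P fun t _ => gaussJordanPivot_ne_zero hP hdet t, Matrix.det_one,
    Finset.prod_inv_distrib] at h
  exact (inv_mul_eq_one₀ (Finset.prod_ne_zero_iff.2 fun t _ =>
    gaussJordanPivot_ne_zero hP hdet t)).1 h.symm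

/-- The pivotal row after division by the pivot has entries of absolute value at most `1`. -/
theorem abs_gaussJordanInter_odd_pivot_row_le {P : Matrix (Fin n) (Fin n) K}
    (hP : IsProperlyArranged P) (hdet : P.det ≠ 0) {k : ℕ} (hk : k < n) (j : Fin n) :
    |gaussJordanInter P (2 * k + 1) ⟨k, hk⟩ j| ≤ 1 := by
  rw [gaussJordanInter_odd_apply P hk, if_pos rfl, ← gaussJordanPivot_of_lt P hk]
  have hp := gaussJordanPivot_ne_zero hP hdet
  by_cases hj : (j : ℕ) < k
  · rw [gaussJordanInter_col P hk.le (fun t _ => hp t) _ j hj, if_neg]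
    · simp
    · rintro rfl
      simp at hj
  · rw [abs_mul, abs_inv, inv_mul_le_iff₀ (abs_pos.2 (hp k)), mul_one]
    exact abs_gaussJordanInter_le_pivot hP hk (fun t _ => hp t) _ _ le_rfl (not_lt.1 hj)

/-- No inverse of a pivot is needed in `O`: the divided row is bounded by `1`, and clearing uses
only sums and products. -/
theorem gaussJordanInter_mem {O : Subring K}
    (hO : ∀ x y : K, y ∈ O → |x| ≤ |y| → x ∈ O) {P : Matrix (Fin n) (Fin n) K}
    (hP : IsProperlyArranged P)
    (hdet : P.det ≠ 0) (hPO : ∀ i j, P i j ∈ O) {q : ℕ} (hq : q ≤ 2 * n) (i j : Fin n) :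
    gaussJordanInter P q i j ∈ O := by
  have hrow : ∀ {k : ℕ} (hk : k < n) (j : Fin n),
      gaussJordanInter P (2 * k + 1) ⟨k, hk⟩ j ∈ O := fun hk j =>
    hO _ 1 O.one_mem (by simpa using abs_gaussJordanInter_odd_pivot_row_le hP hdet hk j)
  have hodd : ∀ {k : ℕ} (_ : k < n), (∀ i j, gaussJordanInter P (2 * k) i j ∈ O) →
      ∀ i j, gaussJordanInter P (2 * k + 1) i j ∈ O := by
    intro k hk h i j
    by_cases hi : i = ⟨k, hk⟩
    · rw [hi]
      exact hrow hk j
    · rw [gaussJordanInter_odd_apply P hk, if_neg hi, one_mul]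
      exact h i j
  have heven : ∀ k ≤ n, ∀ i j, gaussJordanInter P (2 * k) i j ∈ O := by
    intro k
    induction k with
    | zero => exact fun _ => hPO
    | succ k ih =>
      intro hk i j
      have hkn : k < n := hk
      rw [gaussJordanInter_even_apply P hkn]
      refine O.add_mem (hodd hkn (ih hkn.le) i j) (O.mul_mem ?_ (hrow hkn j))
      split_ifs
      · exact O.zero_mem
      · exact O.neg_mem (ih hkn.le _ _)
  rcases Nat.even_or_odd' q with ⟨k, rfl | rfl⟩
  · exact heven k (by omega) i j
  · exact hodd (by omega) (heven k (by omega)) i j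

theorem gaussJordanPivot_inv_mem {O : Subring K}
    (hO : ∀ x y : K, y ∈ O → |x| ≤ |y| → x ∈ O) {P : Matrix (Fin n) (Fin n) K}
    (hP : IsProperlyArranged P)
    (hdet : P.det ≠ 0) (hPO : ∀ i j, P i j ∈ O) (hd : P.det⁻¹ ∈ O) {k : ℕ} (hk : k < n) :
    (gaussJordanPivot P k)⁻¹ ∈ O := by
  have hp := gaussJordanPivot_ne_zero hP hdet k
  have h := prod_gaussJordanPivot hP hdet
  rw [← Finset.mul_prod_erase _ _ (Finset.mem_range.2 hk)] at h
  -- The pivots multiply to `P.det`, so an inverse pivot is `P.det⁻¹` times the other pivots.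
  have h' : (gaussJordanPivot P k)⁻¹ =
      P.det⁻¹ * ∏ t ∈ (Finset.range n).erase k, gaussJordanPivot P t := by
    field_simp
    linear_combination -h
  rw [h']
  refine O.mul_mem hd (O.prod_mem fun t ht => ?_)
  have htn := Finset.mem_range.1 (Finset.mem_of_mem_erase ht)
  rw [gaussJordanPivot_of_lt P htn]
  exact gaussJordanInter_mem hO hP hdet hPO (by omega) _ _

theorem gaussJordanOp_mem {O : Subring K}
    (hO : ∀ x y : K, y ∈ O → |x| ≤ |y| → x ∈ O) {P : Matrix (Fin n) (Fin n) K}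
    (hP : IsProperlyArranged P)
    (hdet : P.det ≠ 0) (hPO : ∀ i j, P i j ∈ O) (hd : P.det⁻¹ ∈ O) {q : ℕ} (hq : q < 2 * n)
    (i j : Fin n) : gaussJordanOp P (q + 1) i j ∈ O := by
  rcases Nat.even_or_odd' q with ⟨k, rfl | rfl⟩
  · have hk : k < n := by omega
    rw [gaussJordanOp, gaussJordanNext_even _ hk]
    unfold gaussJordanScale
    rw [← gaussJordanPivot_of_lt P hk]
    split_ifs
    · exact gaussJordanPivot_inv_mem hO hP hdet hPO hd hk
    · exact O.one_mem
    · exact O.zero_mem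
  · have hk : k < n := by omega
    rw [gaussJordanOp, gaussJordanNext_odd _ hk]
    unfold gaussJordanClear
    split_ifs
    · exact O.one_mem
    · exact O.neg_mem (gaussJordanInter_mem hO hP hdet hPO (by omega) _ _)
    · exact O.zero_mem

theorem gaussJordanOp_diag {O : Subring K}
    (hO : ∀ x y : K, y ∈ O → |x| ≤ |y| → x ∈ O) {P : Matrix (Fin n) (Fin n) K}
    (hP : IsProperlyArranged P)
    (hdet : P.det ≠ 0) (hPO : ∀ i j, P i j ∈ O) {q : ℕ} (hq : q < 2 * n) (i : Fin n) :
    gaussJordanOp P (q + 1) i i ≠ 0 ∧ (gaussJordanOp P (q + 1) i i)⁻¹ ∈ O := by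
  rcases Nat.even_or_odd' q with ⟨k, rfl | rfl⟩
  · have hk : k < n := by omega
    rw [gaussJordanOp, gaussJordanNext_even _ hk]
    unfold gaussJordanScale
    rw [← gaussJordanPivot_of_lt P hk, if_pos rfl]
    split_ifs
    · refine ⟨inv_ne_zero (gaussJordanPivot_ne_zero hP hdet k), ?_⟩
      rw [inv_inv, gaussJordanPivot_of_lt P hk]
      exact gaussJordanInter_mem hO hP hdet hPO (by omega) _ _
    · exact ⟨one_ne_zero, by simp [O.one_mem]⟩
  · have hk : k < n := by omega
    rw [gaussJordanOp, gaussJordanNext_odd _ hk]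
    unfold gaussJordanClear
    rw [if_pos rfl]
    exact ⟨one_ne_zero, by simp [O.one_mem]⟩

end Elimination

/-! ### Minkowski products and determinants in terms of representatives. -/

section Membership

variable {K : Type*} [Field K] {n : ℕ}

theorem mem_sum_mul {ι : Type*} [Fintype ι] (α ξ : ι → Set K) (y : K) :
    y ∈ ∑ k, α k * ξ k ↔
      ∃ a z : ι → K, (∀ k, a k ∈ α k) ∧ (∀ k, z k ∈ ξ k) ∧ ∑ k, a k * z k = y := by
  rw [Set.mem_fintype_sum]
  constructor
  · rintro ⟨g, hg, rfl⟩
    choose a ha z hz h using fun k => Set.mem_mul.1 (hg k)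
    exact ⟨a, z, ha, hz, by simp [h]⟩
  · rintro ⟨a, z, ha, hz, rfl⟩
    exact ⟨_, fun k => Set.mul_mem_mul (ha k) (hz k), rfl⟩

theorem mem_extMulVec_toExtVec (𝒜 : Matrix (Fin n) (Fin n) (Set K)) (x : Fin n → K) (i : Fin n)
    (y : K) : y ∈ extMulVec 𝒜 (toExtVec x) i ↔
      ∃ a : Fin n → K, (∀ k, a k ∈ 𝒜 i k) ∧ ∑ k, a k * x k = y := by
  unfold extMulVec
  rw [mem_sum_mul]
  constructor
  · rintro ⟨a, z, ha, hz, rfl⟩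
    obtain rfl : z = x := funext hz
    exact ⟨a, ha, rfl⟩
  · rintro ⟨a, ha, rfl⟩
    exact ⟨a, x, ha, fun _ => rfl, rfl⟩

theorem mem_extMulVec_toExtMatrix (G : Matrix (Fin n) (Fin n) K) (ξ : Fin n → Set K) (i : Fin n)
    (y : K) : y ∈ extMulVec (toExtMatrix G) ξ i ↔
      ∃ z : Fin n → K, (∀ k, z k ∈ ξ k) ∧ ∑ k, G i k * z k = y := by
  unfold extMulVec
  rw [mem_sum_mul]
  constructor
  · rintro ⟨a, z, ha, hz, rfl⟩
    obtain rfl : a = G i := funext ha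
    exact ⟨z, hz, rfl⟩
  · rintro ⟨z, hz, rfl⟩
    exact ⟨G i, z, fun _ => rfl, hz, rfl⟩

theorem mem_extMul_toExtMatrix (G : Matrix (Fin n) (Fin n) K)
    (𝒜 : Matrix (Fin n) (Fin n) (Set K)) (i j : Fin n) (y : K) :
    y ∈ extMul (toExtMatrix G) 𝒜 i j ↔
      ∃ z : Fin n → K, (∀ k, z k ∈ 𝒜 k j) ∧ ∑ k, G i k * z k = y :=
  mem_extMulVec_toExtMatrix G (fun k => 𝒜 k j) i y

/-- The representatives are chosen independently for each permutation, so `y` need not be the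
determinant of a representative matrix. -/
theorem mem_extDet (𝒜 : Matrix (Fin n) (Fin n) (Set K)) (y : K) :
    y ∈ extDet 𝒜 ↔ ∃ z : Equiv.Perm (Fin n) → Fin n → K, (∀ σ i, z σ i ∈ 𝒜 (σ i) i) ∧
      ∑ σ : Equiv.Perm (Fin n), ((Equiv.Perm.sign σ : ℤ) : K) * ∏ i, z σ i = y := by
  unfold extDet
  rw [mem_sum_mul]
  constructor
  · rintro ⟨a, z, ha, hz, rfl⟩
    choose g hg h using fun σ => (Set.mem_fintype_prod _ _).1 (hz σ)
    exact ⟨g, hg, Finset.sum_congr rfl fun σ _ => by rw [h, Set.mem_singleton_iff.1 (ha σ)]⟩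
  · rintro ⟨z, hz, rfl⟩
    exact ⟨_, fun σ => ∏ i, z σ i, fun _ => rfl,
      fun σ => (Set.mem_fintype_prod _ _).2 ⟨z σ, hz σ, rfl⟩, rfl⟩

theorem det_mem_extDet {𝒜 : Matrix (Fin n) (Fin n) (Set K)} {P : Matrix (Fin n) (Fin n) K}
    (hP : IsRepresentative 𝒜 P) : P.det ∈ extDet 𝒜 :=
  (mem_extDet _ _).2 ⟨fun σ i => P (σ i) i, fun _ _ => hP _ _, (Matrix.det_apply' P).symm⟩

end Membership

/-! ### Congruences modulo a subgroup and its ring of multipliers. -/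

section Congruence

open scoped Matrix

variable {K : Type*} [Field K] {n : ℕ}

theorem prod_sub_prod_mem {ι : Type*} {O : Subring K} {J : AddSubgroup K}
    (hJ : ∀ r ∈ O, ∀ x ∈ J, r * x ∈ J) (s : Finset ι) (a b : ι → K) (ha : ∀ i ∈ s, a i ∈ O)
    (hb : ∀ i ∈ s, b i ∈ O) (hab : ∀ i ∈ s, a i - b i ∈ J) :
    ∏ i ∈ s, a i - ∏ i ∈ s, b i ∈ J := by
  classical
  induction s using Finset.induction_on with
  | empty => simp
  | insert i s hi ih =>
    simp only [Finset.mem_insert, forall_eq_or_imp] at ha hb hab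
    rw [Finset.prod_insert hi, Finset.prod_insert hi,
      show a i * ∏ i ∈ s, a i - b i * ∏ i ∈ s, b i =
        (∏ i ∈ s, a i) * (a i - b i) + b i * (∏ i ∈ s, a i - ∏ i ∈ s, b i) by ring]
    exact J.add_mem (hJ _ (O.prod_mem ha.2) _ hab.1) (hJ _ hb.1 _ (ih ha.2 hb.2 hab.2))

theorem sub_det_mem_of_forall_prod_sub_mem {𝒜 : Matrix (Fin n) (Fin n) (Set K)}
    {P : Matrix (Fin n) (Fin n) K} {J : AddSubgroup K}
    (h : ∀ (σ : Equiv.Perm (Fin n)) (z : Fin n → K), (∀ i, z i ∈ 𝒜 (σ i) i) →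
      ∏ i, z i - ∏ i, P (σ i) i ∈ J) {y : K} (hy : y ∈ extDet 𝒜) : y - P.det ∈ J := by
  obtain ⟨z, hz, rfl⟩ := (mem_extDet _ _).1 hy
  rw [Matrix.det_apply', ← Finset.sum_sub_distrib]
  refine J.sum_mem fun σ _ => ?_
  rw [← mul_sub]
  rcases Int.units_eq_one_or (Equiv.Perm.sign σ) with e | e <;> rw [e]
  · simpa using h σ _ (hz σ)
  · simpa using J.neg_mem (h σ _ (hz σ))

/-- The subring of the numbers `c` such that `c H ⊆ H`. -/
def multiplierSubring (H : AddSubgroup K) : Subring K where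
  carrier := {c | ∀ x ∈ H, c * x ∈ H}
  mul_mem' := fun {a b} ha hb x hx => by
    rw [mul_assoc]
    exact ha _ (hb _ hx)
  one_mem' := fun x hx => by simpa using hx
  add_mem' := fun {a b} ha hb x hx => by
    rw [add_mul]
    exact H.add_mem (ha _ hx) (hb _ hx)
  zero_mem' := fun x _ => by simp
  neg_mem' := fun {a} ha x hx => by
    rw [neg_mul]
    exact H.neg_mem (ha _ hx)

/-- The errors which do not contribute when multiplied by a vector congruent to `b` modulo `B`. -/
def errorIdeal (B : AddSubgroup K) (b : Fin n → K) : AddSubgroup K where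
  carrier := {w | w ∈ multiplierSubring B ∧ ∀ i, w * b i ∈ B}
  add_mem' := fun hx hy => ⟨add_mem hx.1 hy.1, fun i => by
    rw [add_mul]
    exact B.add_mem (hx.2 i) (hy.2 i)⟩
  zero_mem' := ⟨zero_mem _, fun i => by simp⟩
  neg_mem' := fun hx => ⟨neg_mem hx.1, fun i => by
    rw [neg_mul]
    exact B.neg_mem (hx.2 i)⟩

theorem errorIdeal_mul_mem {B : AddSubgroup K} {b : Fin n → K} (r : K)
    (hr : r ∈ multiplierSubring B) (x : K) (hx : x ∈ errorIdeal B b) : r * x ∈ errorIdeal B b :=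
  ⟨mul_mem hr hx.1, fun i => by
    rw [mul_assoc]
    exact hr _ (hx.2 i)⟩

theorem det_mem_subring {O : Subring K} {P : Matrix (Fin n) (Fin n) K} (hP : ∀ i j, P i j ∈ O) :
    P.det ∈ O := by
  rw [Matrix.det_apply']
  exact O.sum_mem fun σ _ => O.mul_mem (intCast_mem O _) (O.prod_mem fun i _ => hP _ _)

/-- By `hsol`, replacing the entries of `P` by other representatives changes `P x` only by elements
of `B`. This serves for the original system and for both transformed ones. -/
theorem flexSolution_eq {B : AddSubgroup K} {𝒜 : Matrix (Fin n) (Fin n) (Set K)}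
    {P : Matrix (Fin n) (Fin n) K} {ξ : Fin n → Set K} {y b : Fin n → K}
    (hξ : ∀ i x, x ∈ ξ i ↔ x - y i ∈ B) (hP : IsRepresentative 𝒜 P)
    (h𝒜 : ∀ i j, ∀ a ∈ 𝒜 i j, a - P i j ∈ errorIdeal B b)
    (hsol : ∀ x : Fin n → K, (∀ i, (P *ᵥ x) i - y i ∈ B) →
      ∀ w ∈ errorIdeal B b, ∀ j, w * x j ∈ B) :
    flexSolution 𝒜 ξ = {x | ∀ i, (P *ᵥ x) i - y i ∈ B} := by
  ext x
  constructor
  · intro hx i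
    exact (hξ i _).1 (hx i ((mem_extMulVec_toExtVec _ _ _ _).2 ⟨P i, hP i, rfl⟩))
  · intro hx i z hz
    obtain ⟨a, ha, rfl⟩ := (mem_extMulVec_toExtVec _ _ _ _).1 hz
    rw [hξ]
    have h : ∑ k, (a k - P i k) * x k ∈ B :=
      B.sum_mem fun k _ => hsol x hx _ (h𝒜 i k _ (ha k)) k
    have h' := B.add_mem h (hx i)
    simp only [sub_mul, Finset.sum_sub_distrib] at h'
    simpa [Matrix.mulVec, dotProduct] using h'

end Congruence

/-! ### Neutrices as subgroups closed under decreasing absolute value. -/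

section Neutrices

variable {K : Type*} [Field K] [LinearOrder K]

theorem exists_addSubgroup_iUnion {ι : Type*} [Nonempty ι] (H : ι → AddSubgroup K)
    (hH : ∀ i, ∀ x y : K, y ∈ H i → |x| ≤ |y| → x ∈ H i) :
    ∃ U : AddSubgroup K, (∀ x y : K, y ∈ U → |x| ≤ |y| → x ∈ U) ∧ ∀ x, x ∈ U ↔ ∃ i, x ∈ H i := by
  refine ⟨⟨⟨⟨{x | ∃ i, x ∈ H i}, ?_⟩, ?_⟩, ?_⟩, ?_, fun _ => Iff.rfl⟩
  · rintro x y ⟨i, hi⟩ ⟨j, hj⟩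
    rcases le_total |x| |y| with h | h
    · exact ⟨j, (H j).add_mem (hH j _ _ hj h) hj⟩
    · exact ⟨i, (H i).add_mem hi (hH i _ _ hi h)⟩
  · exact ⟨Classical.arbitrary ι, (H _).zero_mem⟩
  · rintro x ⟨i, hi⟩
    exact ⟨i, (H i).neg_mem hi⟩
  · rintro x y ⟨i, hi⟩ hxy
    exact ⟨i, hH i _ _ hi hxy⟩

theorem abs_mem_extAbs {α : Set K} {a : K} (ha : a ∈ α) : |a| ∈ extAbs α :=
  Set.mem_add.2 ⟨|a|, ⟨a, ha, rfl⟩, 0, Set.mem_sub.2 ⟨a, ha, a, ha, sub_self a⟩, add_zero _⟩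

variable [IsStrictOrderedRing K]

theorem IsExternalNumber.exists_addSubgroup {α : Set K} (hα : IsExternalNumber α) :
    ∃ (a : K) (H : AddSubgroup K), (∀ x y : K, y ∈ H → |x| ≤ |y| → x ∈ H) ∧
      (∀ x, x ∈ α ↔ x - a ∈ H) ∧ neutrixPart α = H := by
  obtain ⟨a, _, ⟨H, rfl, hH⟩, rfl⟩ := hα
  have hmem : ∀ x, x ∈ ({a} : Set K) + (H : Set K) ↔ x - a ∈ H := fun x => by
    simp [Set.singleton_add, sub_eq_neg_add]
  refine ⟨a, H, fun x y hy hxy => ?_, hmem, ?_⟩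
  · have h1 : |y| ∈ (H : Set K) := by
      rcases abs_choice y with e | e <;> rw [e]
      · exact hy
      · exact H.neg_mem hy
    exact hH.out (H.neg_mem h1) h1 (abs_le.1 hxy)
  · ext x
    unfold neutrixPart
    rw [Set.mem_sub]
    constructor
    · rintro ⟨y, hy, z, hz, rfl⟩
      rw [hmem] at hy hz
      simpa using H.sub_mem hy hz
    · intro hx
      exact ⟨a + x, (hmem _).2 (by simpa using hx), a, (hmem _).2 (by simp), by ring⟩

theorem isExternalNumber_of_mem_iff {α : Set K} {a : K} {H : AddSubgroup K}
    (hH : ∀ x y : K, y ∈ H → |x| ≤ |y| → x ∈ H) (hα : ∀ x, x ∈ α ↔ x - a ∈ H) :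
    IsExternalNumber α := by
  refine ⟨a, H, ⟨H, rfl, ⟨fun x hx y hy z hz => ?_⟩⟩, ?_⟩
  · rcases abs_le_max_abs_abs hz.1 hz.2 |> le_max_iff.1 with h | h
    · exact hH _ _ hx h
    · exact hH _ _ hy h
  · ext x
    simp [hα, Set.singleton_add, sub_eq_neg_add]

/-- The limited numbers as a subring. -/
def limitedSubring (K : Type*) [Field K] [LinearOrder K] [IsStrictOrderedRing K] : Subring K where
  carrier := limitedNumbers K
  mul_mem' := by
    rintro a b ⟨m, hm⟩ ⟨l, hl⟩
    refine ⟨m * l, ?_⟩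
    rw [abs_mul, Nat.cast_mul]
    exact mul_le_mul hm hl (abs_nonneg _) (Nat.cast_nonneg _)
  one_mem' := ⟨1, by simp⟩
  add_mem' := by
    rintro a b ⟨m, hm⟩ ⟨l, hl⟩
    refine ⟨m + l, ?_⟩
    rw [Nat.cast_add]
    exact (abs_add_le a b).trans (add_le_add hm hl)
  zero_mem' := ⟨0, by simp⟩
  neg_mem' := by
    rintro a ⟨m, hm⟩
    exact ⟨m, by simpa using hm⟩

theorem infinitesimals_subset_limitedNumbers : infinitesimals K ⊆ limitedNumbers K := by
  rintro x (rfl | hx)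
  · exact ⟨0, by simp⟩
  · by_contra h
    have h1 : ∀ y : K, y ∉ limitedNumbers K → 1 < |y| := fun y hy => by
      by_contra! hy1
      exact hy ⟨1, by simpa using hy1⟩
    have h2 := h1 _ hx
    rw [abs_inv] at h2
    exact absurd (inv_lt_one_of_one_lt₀ (h1 _ h)) (not_lt.2 h2.le)

theorem limited_mul_mem {H : AddSubgroup K} (hH : ∀ x y : K, y ∈ H → |x| ≤ |y| → x ∈ H)
    {c x : K} (hc : c ∈ limitedSubring K) (hx : x ∈ H) : c * x ∈ H := by
  obtain ⟨m, hm⟩ := hc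
  refine hH _ (m • x) (H.nsmul_mem hx m) ?_
  rw [nsmul_eq_mul, abs_mul, abs_mul, Nat.abs_cast]
  exact mul_le_mul_of_nonneg_right hm (abs_nonneg _)

theorem multiplierSubring_solid {H : AddSubgroup K}
    (hH : ∀ x y : K, y ∈ H → |x| ≤ |y| → x ∈ H) (x y : K) (hy : y ∈ multiplierSubring H)
    (hxy : |x| ≤ |y|) : x ∈ multiplierSubring H := fun z hz =>
  hH _ _ (hy z hz) (by
    rw [abs_mul, abs_mul]
    exact mul_le_mul_of_nonneg_right hxy (abs_nonneg _))

theorem sub_mem_of_mem_extAbs {α : Set K} {a : K} {H : AddSubgroup K}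
    (hH : ∀ x y : K, y ∈ H → |x| ≤ |y| → x ∈ H) (hα : ∀ x, x ∈ α ↔ x - a ∈ H)
    (hN : neutrixPart α = H) {x y : K} (hx : x ∈ extAbs α) (hy : y ∈ extAbs α) : x - y ∈ H := by
  have key : ∀ z ∈ extAbs α, z - |a| ∈ H := by
    intro z hz
    obtain ⟨_, ⟨b, hb, rfl⟩, u, hu, rfl⟩ := Set.mem_add.1 hz
    rw [hN] at hu
    have h : |b| - |a| ∈ H := hH _ _ ((hα b).1 hb) (abs_abs_sub_abs_le_abs_sub b a)
    simpa [add_sub_right_comm] using H.add_mem h hu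
  simpa using H.sub_mem (key x hx) (key y hy)

end Neutrices

/-! ### From stability to congruences. -/

section StableSystems

variable {K : Type*} [Field K] [LinearOrder K] [IsStrictOrderedRing K] {n : ℕ}

theorem stableSystem_congruences [NeZero n] {𝒜 : Matrix (Fin n) (Fin n) (Set K)}
    {ℬ : Fin n → Set K} (h𝒜 : ∀ i j, IsExternalNumber (𝒜 i j))
    (hℬ : ∀ i, IsExternalNumber (ℬ i)) (huniform : IsUniformVec ℬ)
    (hstable : IsStableSystem 𝒜 ℬ) (hred : IsReducedMatrix 𝒜) :
    ∃ (b : Fin n → K) (B : AddSubgroup K), (∀ x y : K, y ∈ B → |x| ≤ |y| → x ∈ B) ∧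
      (∀ i x, x ∈ ℬ i ↔ x - b i ∈ B) ∧
      (∀ i j, ∀ a ∈ 𝒜 i j, a ∈ multiplierSubring B) ∧
      (∀ i j, ∀ a ∈ 𝒜 i j, ∀ a' ∈ 𝒜 i j, a - a' ∈ errorIdeal B b) ∧
      ∀ δ ∈ extDet 𝒜, δ ≠ 0 ∧ δ⁻¹ ∈ multiplierSubring B := by
  obtain ⟨⟨hlim, hns, hR⟩, hRR, habs⟩ := hstable
  choose a H hHs hHm hHN using fun i j => (h𝒜 i j).exists_addSubgroup
  choose b H' hH's hH'm hH'N using fun i => (hℬ i).exists_addSubgroup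
  obtain ⟨B, hB⟩ : ∃ B, ∀ i, H' i = B := ⟨H' 0, fun i => SetLike.coe_injective (by
    rw [← hH'N, ← hH'N, huniform i 0])⟩
  have hBs := hB 0 ▸ hH's 0
  simp only [hB] at hH'm hH'N
  have hmin : vecMinNeutrix ℬ = B := by
    have : Nonempty (Fin n) := ⟨0⟩
    simp only [vecMinNeutrix, hH'N, Set.iInter_const]
  obtain ⟨U, hUs, hU⟩ := exists_addSubgroup_iUnion (fun p : Fin n × Fin n => H p.1 p.2)
    fun p => hHs p.1 p.2
  have hUmax : matrixMaxNeutrix 𝒜 = U := by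
    ext x
    simp [matrixMaxNeutrix, hHN, hU]
  have hlim' : ∀ i j, ∀ x ∈ 𝒜 i j, x ∈ limitedSubring K := by
    intro i j x hx
    -- Reducedness is needed only to exhibit an entry of maximal absolute value.
    have h1 : (1 : K) ∈ matrixMaxAbs 𝒜 := hred.1 ▸ hred.2.1
    obtain ⟨p, hp, -⟩ := h1
    obtain ⟨y, hy, hxy⟩ := hp (i, j) _ (abs_mem_extAbs hx)
    obtain ⟨m, hm⟩ := hlim.1 ⟨p, hp, hy⟩
    exact ⟨m, hxy.trans ((le_abs_self y).trans hm)⟩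
  have hsubU : ∀ i j, ∀ x ∈ 𝒜 i j, ∀ y ∈ 𝒜 i j, x - y ∈ U := fun i j x hx y hy =>
    (hU _).2 ⟨(i, j), by
      simpa using (H i j).sub_mem ((hHm i j x).1 hx) ((hHm i j y).1 hy)⟩
  have ha : ∀ i j, a i j ∈ 𝒜 i j := fun i j => (hHm i j _).2 (by simp)
  have hUlim : ∀ x ∈ U, x ∈ limitedSubring K := by
    intro x hx
    obtain ⟨⟨i, j⟩, h⟩ := (hU x).1 hx
    have h' : a i j + x ∈ 𝒜 i j := (hHm i j _).2 (by simpa using h)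
    simpa using sub_mem (hlim' i j _ h') (hlim' i j _ (ha i j))
  have hdetU : ∀ δ ∈ extDet 𝒜, δ - (Matrix.of a).det ∈ U := fun δ hδ =>
    sub_det_mem_of_forall_prod_sub_mem (fun σ z hz =>
      prod_sub_prod_mem (O := limitedSubring K) (fun r hr x hx => limited_mul_mem hUs hr hx) _ _ _
        (fun i _ => hlim' _ _ _ (hz i)) (fun i _ => hlim' _ _ _ (ha _ _))
        fun i _ => hsubU _ _ _ (hz i) _ (ha _ _)) hδ
  have hdetlim : ∀ δ ∈ extDet 𝒜, δ ∈ limitedSubring K := by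
    intro δ hδ
    have h := det_mem_subring (P := Matrix.of a) (O := limitedSubring K)
      fun i j => hlim' _ _ _ (ha i j)
    simpa using add_mem (hUlim _ (hdetU δ hδ)) h
  have hne : ∀ δ ∈ extDet 𝒜, δ ≠ 0 := fun δ hδ h => hns (h ▸ hδ)
  have hquot : ∀ δ ∈ extDet 𝒜, ∀ δ' ∈ extDet 𝒜, δ / δ' ∈ limitedSubring K := by
    intro δ hδ δ' hδ'
    have hu : δ - δ' ∈ U := by simpa using U.sub_mem (hdetU δ hδ) (hdetU δ' hδ')
    have h := infinitesimals_subset_limitedNumbers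
      (hR (Set.div_mem_div (hUmax ▸ hu : δ - δ' ∈ matrixMaxNeutrix 𝒜) hδ'))
    have h' : δ / δ' = 1 + (δ - δ') / δ' := by
      have := hne _ hδ'
      field_simp
      ring
    rw [h']
    exact add_mem (one_mem _) h
  have hd := det_mem_extDet (P := Matrix.of a) ha
  have hUb : ∀ u ∈ U, ∀ j, ∀ x ∈ ℬ j, u * x ∈ B := by
    intro u hu j x hx
    have hc := hRR (Set.div_mem_div (hUmax ▸ hu : u ∈ matrixMaxNeutrix 𝒜) hd)
    set d := (Matrix.of a).det
    have hd0 := hne _ hd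
    -- In the zeroless case `u / d = v / y` with `v ∈ B`, so `u y = d v`, and `d` is limited.
    -- Otherwise `0` lies in the maximum and `y = 0` serves.
    obtain ⟨i, hi, y, hy, huy⟩ : ∃ i, (∀ j, extLE (extAbs (ℬ j)) (extAbs (ℬ i))) ∧
        ∃ y ∈ extAbs (ℬ i), u * y ∈ B := by
      unfold vecUncertainty at hc
      rw [hmin] at hc
      split_ifs at hc with hz
      · obtain ⟨v, hv, y, ⟨i, hi, hy⟩, hvy⟩ := Set.mem_div.1 hc
        have hy0 : y ≠ 0 := fun h => hz (h ▸ ⟨i, hi, hy⟩)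
        refine ⟨i, hi, y, hy, ?_⟩
        have h : u * y = d * v := by
          field_simp at hvy
          linear_combination -hvy
        rw [h]
        exact limited_mul_mem hBs (hdetlim _ hd) hv
      · obtain ⟨i, hi, hy⟩ := not_not.1 hz
        refine ⟨i, hi, 0, hy, by simp⟩
    obtain ⟨y', hy', hxy'⟩ := hi j _ (abs_mem_extAbs hx)
    -- Elements of the same absolute value differ by `B`, and `u` is limited.
    have h1 : u * y' ∈ B := by
      have := B.add_mem huy (limited_mul_mem hBs (hUlim u hu)
        (sub_mem_of_mem_extAbs hBs (hH'm i) (hH'N i) hy' hy))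
      rwa [← mul_add, add_sub_cancel] at this
    refine hBs _ _ h1 ?_
    rw [abs_mul, abs_mul]
    exact mul_le_mul_of_nonneg_left (hxy'.trans (le_abs_self _)) (abs_nonneg _)
  refine ⟨b, B, hBs, hH'm, fun i j x hx y hy => limited_mul_mem hBs (hlim' i j x hx) hy,
    fun i j x hx y hy => ⟨fun z hz => limited_mul_mem hBs (hUlim _ (hsubU i j x hx y hy)) hz,
      fun k => hUb _ (hsubU i j x hx y hy) k _ ((hH'm k _).2 (by simp))⟩,
    fun δ hδ => ⟨hne δ hδ, fun x hx => ?_⟩⟩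
  rw [hmin] at habs
  have hsub : extDet 𝒜 * (B : Set K) ⊆ B := by
    rintro _ ⟨δ, hδ, y, hy, rfl⟩
    exact limited_mul_mem hBs (hdetlim δ hδ) hy
  -- As `Δ B ⊆ B` is not strict, `x = δ' y` with `y ∈ B`; then `δ⁻¹ x = (δ' / δ) y`, and `δ' / δ` is
  -- limited because `R(𝒜)` is infinitesimal.
  have hx' : x ∈ extDet 𝒜 * (B : Set K) := by
    by_contra h
    exact habs ⟨hsub, fun h' => h (h' hx)⟩
  obtain ⟨δ', hδ', y, hy, rfl⟩ := hx'
  rw [show δ⁻¹ * (δ' * y) = δ' / δ * y by ring]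
  exact limited_mul_mem hBs (hquot _ hδ' _ hδ) hy

end StableSystems

/-! ### Images of cosets under matrices, and Cramer's rule modulo `B`. -/

section Solution

open scoped Matrix

variable {K : Type*} [Field K] {n : ℕ}

theorem mulVec_mem {B : AddSubgroup K} {G : Matrix (Fin n) (Fin n) K}
    (hG : ∀ i j, G i j ∈ multiplierSubring B) {u : Fin n → K} (hu : ∀ i, u i ∈ B) (i : Fin n) :
    (G *ᵥ u) i ∈ B := by
  rw [Matrix.mulVec, dotProduct]
  exact B.sum_mem fun j _ => hG i j _ (hu j)

/-- Entries in the multiplier ring give one inclusion; `hi`, the surjectivity of row `i` from `Bⁿ`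
to `B`, gives the other. -/
theorem mem_extMulVec_toExtMatrix_iff {B : AddSubgroup K} {G : Matrix (Fin n) (Fin n) K}
    {ξ : Fin n → Set K} {y : Fin n → K} (hξ : ∀ i x, x ∈ ξ i ↔ x - y i ∈ B)
    (hG : ∀ i j, G i j ∈ multiplierSubring B) (i : Fin n)
    (hi : ∀ v ∈ B, ∃ u : Fin n → K, (∀ k, u k ∈ B) ∧ (G *ᵥ u) i = v) (x : K) :
    x ∈ extMulVec (toExtMatrix G) ξ i ↔ x - (G *ᵥ y) i ∈ B := by
  rw [mem_extMulVec_toExtMatrix]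
  constructor
  · rintro ⟨z, hz, rfl⟩
    have h := mulVec_mem hG (u := z - y) (fun k => (hξ k _).1 (hz k)) i
    rwa [Matrix.mulVec_sub] at h
  · intro hx
    obtain ⟨u, hu, h⟩ := hi _ hx
    refine ⟨y + u, fun k => (hξ k _).2 (by simpa using hu k), ?_⟩
    change (G *ᵥ (y + u)) i = x
    rw [Matrix.mulVec_add, Pi.add_apply, h]
    ring

theorem extMul_toExtMatrix_congr {B : AddSubgroup K} {b : Fin n → K}
    {𝒜 : Matrix (Fin n) (Fin n) (Set K)} {G P : Matrix (Fin n) (Fin n) K}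
    (hG : ∀ i j, G i j ∈ multiplierSubring B) (hP : IsRepresentative 𝒜 P)
    (h𝒜 : ∀ i j, ∀ a ∈ 𝒜 i j, a - P i j ∈ errorIdeal B b) :
    IsRepresentative (extMul (toExtMatrix G) 𝒜) (G * P) ∧
      ∀ i j, ∀ a ∈ extMul (toExtMatrix G) 𝒜 i j, a - (G * P) i j ∈ errorIdeal B b := by
  refine ⟨fun i j => (mem_extMul_toExtMatrix _ _ _ _ _).2 ⟨fun k => P k j, fun k => hP k j, rfl⟩,
    fun i j a ha => ?_⟩
  obtain ⟨z, hz, rfl⟩ := (mem_extMul_toExtMatrix _ _ _ _ _).1 ha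
  rw [Matrix.mul_apply, ← Finset.sum_sub_distrib]
  refine AddSubgroup.sum_mem _ fun k _ => ?_
  rw [← mul_sub]
  exact errorIdeal_mul_mem _ (hG i k) _ (h𝒜 k j _ (hz k))

/-- The determinant obtained by substituting the right-hand member for column `j`. -/
theorem mem_extDet_updateCol_iff {B : AddSubgroup K} {b : Fin n → K}
    {𝒜 : Matrix (Fin n) (Fin n) (Set K)} {ℬ : Fin n → Set K} {P : Matrix (Fin n) (Fin n) K}
    (hℬ : ∀ i x, x ∈ ℬ i ↔ x - b i ∈ B) (hP : IsRepresentative 𝒜 P)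
    (hO : ∀ i j, ∀ a ∈ 𝒜 i j, a ∈ multiplierSubring B)
    (h𝒜 : ∀ i j, ∀ a ∈ 𝒜 i j, a - P i j ∈ errorIdeal B b)
    (hdet : P.det ≠ 0) (hd : P.det⁻¹ ∈ multiplierSubring B) (j : Fin n) (x : K) :
    x ∈ extDet (𝒜.updateCol j ℬ) ↔ x - (P.updateCol j b).det ∈ B := by
  constructor
  · refine sub_det_mem_of_forall_prod_sub_mem fun σ z hz => ?_
    have hzj : z j - b (σ j) ∈ B := by
      simpa [hℬ] using hz j
    have hz' : ∀ i ∈ Finset.univ.erase j, z i ∈ 𝒜 (σ i) i := fun i hi => by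
      simpa [Matrix.updateCol_apply, Finset.ne_of_mem_erase hi] using hz i
    have hb : ∏ i, P.updateCol j b (σ i) i =
        b (σ j) * ∏ i ∈ Finset.univ.erase j, P (σ i) i := by
      rw [← Finset.mul_prod_erase _ _ (Finset.mem_univ j), Matrix.updateCol_self]
      congr 1
      exact Finset.prod_congr rfl fun i hi => Matrix.updateCol_ne (Finset.ne_of_mem_erase hi)
    rw [hb, ← Finset.mul_prod_erase _ _ (Finset.mem_univ j)]
    have h1 := prod_sub_prod_mem (O := multiplierSubring B) (J := errorIdeal B b)
      errorIdeal_mul_mem (Finset.univ.erase j) z (fun i => P (σ i) i)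
      (fun i hi => hO _ _ _ (hz' i hi)) (fun i _ => hO _ _ _ (hP _ _))
      fun i hi => h𝒜 _ _ _ (hz' i hi)
    have h2 := (multiplierSubring B).prod_mem (t := Finset.univ.erase j) (f := z)
      fun i hi => hO _ _ _ (hz' i hi)
    have h3 := B.add_mem (h2 _ hzj) (h1.2 (σ j))
    rw [show z j * ∏ i ∈ Finset.univ.erase j, z i -
        b (σ j) * ∏ i ∈ Finset.univ.erase j, P (σ i) i =
      (∏ i ∈ Finset.univ.erase j, z i) * (z j - b (σ j)) +
        (∏ i ∈ Finset.univ.erase j, z i - ∏ i ∈ Finset.univ.erase j, P (σ i) i) * b (σ j) by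
      ring]
    exact h3
  · intro hx
    set v := x - (P.updateCol j b).det with hv
    -- Adding `v / det P` times column `j` of `P` to `b` raises the determinant by exactly `v` and
    -- moves `b` only within `B`.
    have h := det_mem_extDet (𝒜 := 𝒜.updateCol j ℬ)
      (P := P.updateCol j (b + (P.det⁻¹ * v) • fun i => P i j)) fun i k => by
        rw [Matrix.updateCol_apply, Matrix.updateCol_apply]
        split_ifs
        · rw [hℬ]
          simpa [mul_comm] using hO _ _ _ (hP i j) _ (hd _ hx)
        · exact hP i k
    rw [Matrix.det_updateCol_add, Matrix.det_updateCol_smul, Matrix.updateCol_eq_self,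
      mul_right_comm, inv_mul_cancel₀ hdet, one_mul, hv, add_sub_cancel] at h
    exact h

/-- The classical rule gives the numerator `P.det * y j` modulo `B`; replacing `P.det` by another
`δ` costs `(δ - P.det) * y j`, which lies in `B` by `hyJ`, and `δ⁻¹` preserves `B`. -/
theorem mem_cramerVec_iff {B : AddSubgroup K} {b : Fin n → K}
    {𝒜 : Matrix (Fin n) (Fin n) (Set K)} {ℬ : Fin n → Set K} {P : Matrix (Fin n) (Fin n) K}
    (hℬ : ∀ i x, x ∈ ℬ i ↔ x - b i ∈ B) (hP : IsRepresentative 𝒜 P)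
    (hO : ∀ i j, ∀ a ∈ 𝒜 i j, a ∈ multiplierSubring B)
    (h𝒜 : ∀ i j, ∀ a ∈ 𝒜 i j, a - P i j ∈ errorIdeal B b)
    (hΔ : ∀ δ ∈ extDet 𝒜, δ ≠ 0 ∧ δ⁻¹ ∈ multiplierSubring B)
    {y : Fin n → K} (hy : P *ᵥ y = b) (hyJ : ∀ w ∈ errorIdeal B b, ∀ j, w * y j ∈ B)
    (j : Fin n) (x : K) : x ∈ cramerVec 𝒜 ℬ j ↔ x - y j ∈ B := by
  obtain ⟨hdet, hd⟩ := hΔ _ (det_mem_extDet hP)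
  have hM := mem_extDet_updateCol_iff hℬ hP hO h𝒜 hdet hd j
  have hcr : (P.updateCol j b).det = P.det * y j := by
    have h : P.adjugate *ᵥ (P *ᵥ y) = P.det • y := by
      rw [Matrix.mulVec_mulVec, Matrix.adjugate_mul, Matrix.smul_mulVec, Matrix.one_mulVec]
    rw [hy, ← Matrix.cramer_eq_adjugate_mulVec] at h
    simpa [Matrix.cramer_apply] using congrFun h j
  have hdO : P.det ∈ multiplierSubring B := det_mem_subring fun i j => hO _ _ _ (hP i j)
  unfold cramerVec
  rw [Set.mem_div]
  constructor
  · rintro ⟨p, hp, δ, hδ, rfl⟩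
    obtain ⟨hδ0, hδO⟩ := hΔ δ hδ
    rw [hM, hcr] at hp
    have hδJ : δ - P.det ∈ errorIdeal B b :=
      sub_det_mem_of_forall_prod_sub_mem (fun σ z hz =>
        prod_sub_prod_mem (O := multiplierSubring B) errorIdeal_mul_mem _ _ _
          (fun i _ => hO _ _ _ (hz i)) (fun i _ => hO _ _ _ (hP _ _))
          fun i _ => h𝒜 _ _ _ (hz i)) hδ
    have h := hδO _ (B.sub_mem hp (hyJ _ hδJ j))
    rw [show p / δ - y j = δ⁻¹ * (p - P.det * y j - (δ - P.det) * y j) by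
      field_simp
      ring]
    exact h
  · intro hx
    refine ⟨P.det * x, ?_, P.det, det_mem_extDet hP, by field_simp⟩
    rw [hM, hcr, ← mul_sub]
    exact hdO _ hx

end Solution

/-! ### The main theorem. -/

open scoped Matrix in
theorem theorem2 {K : Type*} [Field K] [LinearOrder K] [IsStrictOrderedRing K]
    {n : ℕ} [NeZero n]
    (𝒜 : Matrix (Fin n) (Fin n) (Set K)) (ℬ : Fin n → Set K)
    (h𝒜 : ∀ i j, IsExternalNumber (𝒜 i j)) (hℬ : ∀ i, IsExternalNumber (ℬ i))
    (huniform : IsUniformVec ℬ) (hstable : IsStableSystem 𝒜 ℬ)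
    (P : Matrix (Fin n) (Fin n) K) (hP : IsProperlyArrangedWrt 𝒜 P) :
    -- the Gauss-Jordan solution does not depend on the representative matrix
    (∀ Q : Matrix (Fin n) (Fin n) K, IsProperlyArrangedWrt 𝒜 Q →
      gaussJordanSolution Q 𝒜 ℬ = gaussJordanSolution P 𝒜 ℬ) ∧
    -- `S = G`
    flexSolution 𝒜 ℬ = gaussJordanSolution P 𝒜 ℬ ∧
    -- `G = 𝒢^P(ℬ)`, as sets of real vectors
    gaussJordanSolution P 𝒜 ℬ = extVecSet (gaussJordanVec P ℬ (2 * n)) ∧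
    -- `𝒢^P(ℬ)` is the vector given by Cramer's rule, and it is an external vector
    gaussJordanVec P ℬ (2 * n) = cramerVec 𝒜 ℬ ∧
    (∀ i, IsExternalNumber (cramerVec 𝒜 ℬ i)) ∧
    -- the same holds if `𝒢^P` is first multiplied out to a single real matrix
    flexSolution 𝒜 ℬ =
      flexSolution (extMul (toExtMatrix (gaussJordanProd P (2 * n))) 𝒜)
        (extMulVec (toExtMatrix (gaussJordanProd P (2 * n))) ℬ) ∧
    extMulVec (toExtMatrix (gaussJordanProd P (2 * n))) ℬ = cramerVec 𝒜 ℬ := by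
  obtain ⟨b, B, hBs, hβ, hO, hJ, hΔ⟩ :=
    stableSystem_congruences h𝒜 hℬ huniform hstable hP.1
  have key : ∀ P, IsProperlyArrangedWrt 𝒜 P →
      flexSolution 𝒜 ℬ = gaussJordanSolution P 𝒜 ℬ ∧
      gaussJordanSolution P 𝒜 ℬ = extVecSet (gaussJordanVec P ℬ (2 * n)) ∧
      gaussJordanVec P ℬ (2 * n) = cramerVec 𝒜 ℬ ∧
      (∀ i, IsExternalNumber (cramerVec 𝒜 ℬ i)) ∧
      flexSolution 𝒜 ℬ =
        flexSolution (extMul (toExtMatrix (gaussJordanProd P (2 * n))) 𝒜)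
          (extMulVec (toExtMatrix (gaussJordanProd P (2 * n))) ℬ) ∧
      extMulVec (toExtMatrix (gaussJordanProd P (2 * n))) ℬ = cramerVec 𝒜 ℬ := by
    rintro P ⟨-, -, hrep, hPA⟩
    obtain ⟨hdet, hd⟩ := hΔ _ (det_mem_extDet hrep)
    have hsolid := multiplierSubring_solid hBs
    have hPO : ∀ i j, P i j ∈ multiplierSubring B := fun i j => hO _ _ _ (hrep i j)
    have hPJ : ∀ i j, ∀ a ∈ 𝒜 i j, a - P i j ∈ errorIdeal B b := fun i j a ha =>
      hJ _ _ _ ha _ (hrep i j)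
    have hopO := fun {q : ℕ} (hq : q < 2 * n) => gaussJordanOp_mem hsolid hPA hdet hPO hd hq
    have hprodO : ∀ q ≤ 2 * n, ∀ i j, gaussJordanProd P q i j ∈ multiplierSubring B := by
      intro q
      induction q with
      | zero =>
        intro _ i j
        rw [gaussJordanProd, Matrix.one_apply]
        split_ifs
        exacts [one_mem _, zero_mem _]
      | succ q ih =>
        intro hq i j
        rw [gaussJordanProd, Matrix.mul_apply]
        exact sum_mem fun k _ => mul_mem (hopO (by omega) i k) (ih (by omega) k j)
    have hvec : ∀ q ≤ 2 * n, ∀ i x,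
        x ∈ gaussJordanVec P ℬ q i ↔ x - (gaussJordanProd P q *ᵥ b) i ∈ B := by
      intro q
      induction q with
      | zero => simpa [gaussJordanVec, gaussJordanProd] using hβ
      | succ q ih =>
        intro hq i x
        obtain ⟨h0, hinv⟩ := gaussJordanOp_diag hsolid hPA hdet hPO (q := q) (by omega) i
        rw [gaussJordanVec, gaussJordanProd, ← Matrix.mulVec_mulVec]
        refine mem_extMulVec_toExtMatrix_iff (ih (by omega)) (hopO (by omega)) i
          -- The diagonal entry alone already maps `B` onto `B`, its inverse being a multiplier.
          (fun v hv => ⟨Pi.single i ((gaussJordanOp P (q + 1) i i)⁻¹ * v), fun k => ?_, ?_⟩) x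
        · by_cases hk : k = i
          · subst hk
            simpa using hinv v hv
          · simp [hk, B.zero_mem]
        · rw [Matrix.mulVec_single]
          simp
          field_simp
    have hmat : ∀ q ≤ 2 * n, IsRepresentative (gaussJordanMatrix P 𝒜 q) (gaussJordanInter P q) ∧
        ∀ i j, ∀ a ∈ gaussJordanMatrix P 𝒜 q i j,
          a - gaussJordanInter P q i j ∈ errorIdeal B b := by
      intro q
      induction q with
      | zero => exact fun _ => ⟨hrep, hPJ⟩
      | succ q ih =>
        intro hq
        exact extMul_toExtMatrix_congr (hopO (by omega)) (ih (by omega)).1 (ih (by omega)).2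
    have hone := gaussJordanInter_two_mul P fun t _ => gaussJordanPivot_ne_zero hPA hdet t
    have hGP : gaussJordanProd P (2 * n) * P = 1 := by
      rw [← gaussJordanInter_eq_prod_mul, hone]
    have hPG : P * gaussJordanProd P (2 * n) = 1 := mul_eq_one_comm.1 hGP
    have hGO := hprodO _ le_rfl
    have hvec' := hvec _ le_rfl
    have hmat' := hmat _ le_rfl
    rw [hone] at hmat'
    have hprodvec : ∀ i x, x ∈ extMulVec (toExtMatrix (gaussJordanProd P (2 * n))) ℬ i ↔
        x - (gaussJordanProd P (2 * n) *ᵥ b) i ∈ B := fun i x =>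
      mem_extMulVec_toExtMatrix_iff hβ hGO i (fun v hv =>
        ⟨P *ᵥ Pi.single i v, mulVec_mem hPO fun k => by
          by_cases hk : k = i
          · subst hk
            simpa using hv
          · simp [hk, B.zero_mem], by
          rw [Matrix.mulVec_mulVec, hGP]
          simp⟩) x
    have hprodmat := extMul_toExtMatrix_congr hGO hrep hPJ
    rw [hGP] at hprodmat
    set G := gaussJordanProd P (2 * n)
    have hGb : ∀ w ∈ errorIdeal B b, ∀ j, w * (G *ᵥ b) j ∈ B := by
      intro w hw j
      rw [Matrix.mulVec, dotProduct, Finset.mul_sum]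
      refine B.sum_mem fun k _ => ?_
      rw [mul_left_comm]
      exact hGO j k _ (hw.2 k)
    have hPb : P *ᵥ (G *ᵥ b) = b := by
      rw [Matrix.mulVec_mulVec, hPG, Matrix.one_mulVec]
    have hiff : ∀ x : Fin n → K, (∀ i, (P *ᵥ x) i - b i ∈ B) ↔ ∀ i, x i - (G *ᵥ b) i ∈ B := by
      intro x
      constructor
      · intro h i
        have h1 := mulVec_mem hGO (u := P *ᵥ x - b) h i
        rwa [Matrix.mulVec_sub, Matrix.mulVec_mulVec, hGP, Matrix.one_mulVec] at h1
      · intro h i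
        have h1 := mulVec_mem hPO (u := x - G *ᵥ b) h i
        rwa [Matrix.mulVec_sub, hPb] at h1
    have herr : ∀ x : Fin n → K, (∀ i, x i - (G *ᵥ b) i ∈ B) →
        ∀ w ∈ errorIdeal B b, ∀ j, w * x j ∈ B := by
      intro x hx w hw j
      have h1 := B.add_mem (hw.1 _ (hx j)) (hGb w hw j)
      rwa [← mul_add, sub_add_cancel] at h1
    have hcramer := mem_cramerVec_iff hβ hrep hO hPJ hΔ hPb hGb
    have hS := flexSolution_eq hβ hrep hPJ fun x hx => herr x ((hiff x).1 hx)
    simp only [hiff] at hS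
    have hG₁ := flexSolution_eq hvec' hmat'.1 hmat'.2 (by simpa using herr)
    have hG₂ := flexSolution_eq hprodvec hprodmat.1 hprodmat.2 (by simpa using herr)
    simp only [Matrix.one_mulVec] at hG₁ hG₂
    refine ⟨hS.trans hG₁.symm, hG₁.trans ?_, ?_,
      fun i => isExternalNumber_of_mem_iff hBs (hcramer i), hS.trans hG₂.symm, ?_⟩
    · ext x
      exact forall_congr' fun i => (hvec' i (x i)).symm
    · ext i x
      rw [hvec', hcramer]
    · ext i x
      rw [hprodvec, hcramer]
  -- Independence of the representative: both Gauss-Jordan solutions equal `S`.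
  exact ⟨fun Q hQ => (key Q hQ).1.symm.trans (key P hP).1, key P hP⟩
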